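/- **Setting.** A network with two unicast sessions is a finite directed acyclic multigraph $G=(V,E)$ whose edges have unit capacity (parallel edges are allowed), with four distinct nodes $s_1,s_2,t_1,t_2$ such that no edge enters a source $s_i$ and no edge leaves a terminal $t_i$. The connectivity level of $(s_i,t_i)$ is the value of a maximum flow from $s_i$ to $t_i$ in $G$. A network code over $n\ge 1$ time units with edge alphabet $\mathcal X$, $|\mathcal X|=q\ge 2$, and finite message sets $W_1,W_2$ consists of arbitrary (possibly nonlinear) functions: the block in $\mathcal X^n$ sent on an edge $e$ is a function of the blocks on the edges entering the tail of $e$ and of the messages of the sources located at the tail of $e$, and $t_i$ estimates the $i$-th message by a function of the blocks on the edges entering $t_i$. Its error probability is the probability that at least one of the two estimates is wrong when the two messages are independent and uniformly distributed on $W_1$ and $W_2$. For real numbers $R_1,R_2$, the network *supports* the rates $(R_1,R_2)$ if for every $\varepsilon>0$ there are $q\ge2$, $n\ge1$ and such a code with $|W_i|\ge q^{nR_i}$ for $i=1,2$ and error probability at most $\varepsilon$. (In particular, a scalar or vector linear network coding solution with zero error at these rates implies support.) **Theorem.** For all integers $n_1>1$ and $n_2\ge 3n_1/2$ there exists a network with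 two unicast sessions in which the connectivity level of $(s_1,t_1)$ is $n_1$ and that of $(s_2,t_2)$ is $n_2$, and which does not support the rates $R_1=n_1$ and $R_2=n_2-\tfrac{3n_1}{2}+1$. -/

import Mathlib

/-- A network with `k` unicast sessions: a directed acyclic multigraph with vertex set `V` and set
of unit-capacity edges `E` (parallel edges model larger capacities), and `2 k` distinct nodes,
the sources and the terminals.  Sources have no incoming and terminals no outgoing edges. -/
structure UnicastNetwork (k : ℕ) (V E : Type) where
  tail : E → V
  head : E → V
  source : Fin k → V
  terminal : Fin k → V
  acyclic : ∀ v, ¬ Relation.TransGen (fun a b => ∃ e, tail e = a ∧ head e = b) v v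
  source_injective : Function.Injective source
  terminal_injective : Function.Injective terminal
  source_ne_terminal : ∀ i j, source i ≠ terminal j
  head_ne_source : ∀ e i, head e ≠ source i
  tail_ne_terminal : ∀ e i, tail e ≠ terminal i

namespace UnicastNetwork

variable {k : ℕ} {V E : Type}

section Flow

open scoped Classical in
/-- The flow out of `v` minus the flow into `v`. -/
noncomputable def netFlow [Fintype E] (G : UnicastNetwork k V E) (f : E → ℝ) (v : V) : ℝ :=
  (∑ e : E with G.tail e = v, f e) - ∑ e : E with G.head e = v, f e

/-- `f` is a flow from the `i`-th source to the `i`-th terminal, every edge having capacity one. -/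
def IsFlow [Fintype E] (G : UnicastNetwork k V E) (i : Fin k) (f : E → ℝ) : Prop :=
  (∀ e, 0 ≤ f e ∧ f e ≤ 1) ∧
    ∀ v, v ≠ G.source i → v ≠ G.terminal i → G.netFlow f v = 0

/-- The `i`-th session has connectivity level `β`: the maximum value of a flow from the `i`-th
source to the `i`-th terminal is `β`. -/
def HasConnectivityLevel [Fintype E] (G : UnicastNetwork k V E) (i : Fin k) (β : ℕ) : Prop :=
  IsGreatest {x : ℝ | ∃ f : E → ℝ, G.IsFlow i f ∧ G.netFlow f (G.source i) = x} β

end Flow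

/-- A (not necessarily linear) network code over `n` time units.  Every edge carries `n` symbols of
an alphabet with `q` letters, and the message of session `i` is one of `M i` messages. -/
structure Code (G : UnicastNetwork k V E) (q n : ℕ) (M : Fin k → ℕ) where
  /-- The symbols sent on `e` are computed from the messages observed at the tail of `e` and the
  symbols on the edges that enter the tail of `e`. -/
  enc (e : E) : ((i : {i : Fin k // G.source i = G.tail e}) → Fin (M i)) →
    ({e' : E // G.head e' = G.tail e} → Fin n → Fin q) → Fin n → Fin q
  /-- Terminal `i` estimates message `i` from the symbols on its incoming edges. -/
  dec (i : Fin k) : ({e : E // G.head e = G.terminal i} → Fin n → Fin q) → Fin (M i)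
  /-- The symbols on `e` as a function of all messages.  As the graph is acyclic, they are
  determined by the encoding functions. -/
  signal (e : E) : ((i : Fin k) → Fin (M i)) → Fin n → Fin q
  signal_eq (e : E) (w : (i : Fin k) → Fin (M i)) :
    signal e w = enc e (fun i => w i) (fun e' => signal e' w)

namespace Code

variable {G : UnicastNetwork k V E} {q n : ℕ} {M : Fin k → ℕ}

/-- The estimate of message `i` at terminal `i`, when the messages are `w`. -/
def estimate (C : G.Code q n M) (w : (i : Fin k) → Fin (M i)) (i : Fin k) : Fin (M i) :=
  C.dec i fun e => C.signal e w

open scoped Classical in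
/-- The probability that some terminal errs, for independent uniformly distributed messages. -/
noncomputable def errorProb (C : G.Code q n M) : ℝ :=
  ((Finset.univ.filter fun w : (i : Fin k) → Fin (M i) => ∃ i, C.estimate w i ≠ w i).card : ℝ) /
    (Fintype.card ((i : Fin k) → Fin (M i)) : ℝ)

end Code

/-- The network supports the rates `R`, in units of the capacity of an edge: there are network
codes of arbitrarily small error probability in which, over `n` time units, session `i` has at
least `q ^ (n * R i)` messages, `q` being the number of letters of the edge alphabet.  Both `q` and
`n` may be chosen freely; a linear scalar or vector solution is the case of zero error. -/
def Supports (G : UnicastNetwork k V E) (R : Fin k → ℝ) : Prop :=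
  ∀ ε : ℝ, 0 < ε → ∃ q n : ℕ, 2 ≤ q ∧ 1 ≤ n ∧ ∃ M : Fin k → ℕ,
    (∀ i, (q : ℝ) ^ ((n : ℝ) * R i) ≤ (M i : ℝ)) ∧ ∃ C : G.Code q n M, C.errorProb ≤ ε

end UnicastNetwork

/-! ### Counting argument for codes with small error. -/

section Counting

/-! Each large gadget has four bottleneck edges in a row, carrying `A`, `B`, `M`, `N`. Session 2
enters at `A`, `B`, `N` and session 1 at `A`, `M`; terminal 1 sees `B`, `N` and terminal 2 sees `A`,
`M`, `N`. A small gadget is one bottleneck `C` shared by both sessions, and `D` is the direct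
traffic of session 2. With `m` large gadgets, `r` small ones and `d` direct edges, the connectivity
levels are `2m + r` and `3m + r + d`.

At full rate for session 1, `(B, N, C)` has no more values than there are first messages, yet
reveals the first message; so, up to errors, it is a function of that message alone
(`exists_pure_set`). Fix a typical second message `b₀`. Replacing `b` by `b₀` changes neither `B`
nor `N`, nor `M`, which depends on `b` only through `B`; since `M` and `b₀` determine `N`, `M` alone
does. Hence `(A, M, C, D)` gives `N`, then the second message, then `B` from `A`, then the first
message. Thus the rates sum to at most `2m + r + d` (`card_mul_card_le_of_chain`), leaving session 2
at most `d`. For `n₁ = 2m + r` with `r ≤ 1`, the claimed rate exceeds `d` by at least `1/2`. -/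

open scoped Classical in
/-- If `g` determines `w` on most pairs and takes at most as many values as there are `w`'s, then
`g` is a function of `w` on most pairs. -/
theorem exists_pure_set {W₁ W₂ Y : Type*} [Fintype W₁] [Fintype W₂] [Fintype Y]
    (g : W₁ → W₂ → Y) (est : W₁ → W₂ → W₁)
    (hest : ∀ a b a' b', g a b = g a' b' → est a b = est a' b')
    (hcard : Fintype.card Y ≤ Fintype.card W₁) (Err : Finset (W₁ × W₂))
    (hErr : ∀ p, p ∉ Err → est p.1 p.2 = p.1) :
    ∃ Bad : Finset (W₁ × W₂), Bad.card ≤ 3 * Err.card ∧ Err ⊆ Bad ∧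
      ∀ a b b', (a, b) ∉ Bad → (a, b') ∉ Bad → g a b = g a b' := by
  rcases isEmpty_or_nonempty W₁ with h | ⟨⟨a₀⟩⟩
  · exact ⟨Err, by omega, subset_rfl, fun a => (h.false a).elim⟩
  -- Off the range of `g` the default `a₀` is harmless: only the total size of the fibres of `φ`
  -- matters.
  obtain ⟨φ, hφ⟩ : ∃ φ : Y → W₁, ∀ a b, φ (g a b) = est a b := by
    refine ⟨fun y => if h : ∃ p : W₁ × W₂, g p.1 p.2 = y then est h.choose.1 h.choose.2 else a₀,
      fun a b => ?_⟩
    have h : ∃ p : W₁ × W₂, g p.1 p.2 = g a b := ⟨(a, b), rfl⟩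
    simp only [h, dif_pos]
    exact hest _ _ _ _ h.choose_spec
  let c : W₁ → ℕ := fun a => (Finset.univ.filter fun y => φ y = a).card
  let Z : Finset W₁ := Finset.univ.filter fun a => c a = 0
  let T : Finset W₁ := Finset.univ.filter fun a => c a ≠ 1
  have hsum : ∑ a, c a = Fintype.card Y := by
    have := Finset.card_eq_sum_card_fiberwise (f := φ) (s := (Finset.univ : Finset Y))
      (t := Finset.univ) (fun _ _ => by simp)
    simpa [c] using this.symm
  -- The fibres have average size at most one, so fibres with at least two elements are no more
  -- numerous than empty ones.
  have hT : T.card ≤ 2 * Z.card := by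
    have h1 : ∑ a, ((if c a ≠ 1 then 1 else 0) + 1) ≤ ∑ a, (c a + 2 * (if c a = 0 then 1 else 0)) := by
      refine Finset.sum_le_sum fun a _ => ?_
      split_ifs <;> omega
    rw [Finset.sum_add_distrib, Finset.sum_add_distrib, ← Finset.mul_sum, hsum,
      ← Finset.card_filter, ← Finset.card_filter] at h1
    simp only [Finset.sum_const, Finset.card_univ, smul_eq_mul, mul_one] at h1
    change T.card + _ ≤ _ + 2 * Z.card at h1
    omega
  -- A message with empty fibre is never decoded, so its whole row consists of errors.
  have hZ : Z.card * Fintype.card W₂ ≤ Err.card := by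
    rw [← Finset.card_univ, ← Finset.card_product]
    refine Finset.card_le_card fun p hp => ?_
    by_contra hn
    have h0 : c p.1 = 0 := by simpa [Z] using (Finset.mem_product.1 hp).1
    rw [Finset.card_eq_zero, Finset.filter_eq_empty_iff] at h0
    exact h0 (Finset.mem_univ (g p.1 p.2)) ((hφ _ _).trans (hErr p hn))
  refine ⟨Err ∪ T ×ˢ Finset.univ, ?_, Finset.subset_union_left, fun a b b' h h' => ?_⟩
  · refine (Finset.card_union_le _ _).trans ?_
    rw [Finset.card_product, Finset.card_univ]
    nlinarith [Nat.mul_le_mul_right (Fintype.card W₂) hT]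
  · simp only [Finset.mem_union, Finset.mem_product, Finset.mem_univ, and_true, not_or] at h h'
    have hc : c a = 1 := by simpa [T] using h.2
    have h1 : φ (g a b) = a := (hφ _ _).trans (hErr (a, b) h.1)
    have h2 : φ (g a b') = a := (hφ _ _).trans (hErr (a, b') h'.1)
    exact Finset.card_le_one.1 hc.le _ (by simpa using h1) _ (by simpa using h2)

open scoped Classical in
/-- Some column of a finite relation has at most the average size. -/
theorem exists_column_card_mul_le {W₁ W₂ : Type*} [Fintype W₁] [Fintype W₂] [Nonempty W₂]
    (S : Finset (W₁ × W₂)) :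
    ∃ b, (Finset.univ.filter fun a => (a, b) ∈ S).card * Fintype.card W₂ ≤ S.card := by
  by_contra! h
  have hS : S.card = ∑ b, (Finset.univ.filter fun a => (a, b) ∈ S).card := by
    rw [Finset.card_eq_sum_card_fiberwise (f := Prod.snd) (t := Finset.univ) (fun _ _ => by simp)]
    refine Finset.sum_congr rfl fun b _ => ?_
    refine Finset.card_bij' (fun p _ => p.1) (fun a _ => (a, b)) ?_ ?_ ?_ ?_ <;>
      simp +contextual [Prod.ext_iff]
    rintro x y h rfl
    exact h
  have h1 := Finset.sum_lt_sum_of_nonempty (Finset.univ_nonempty (α := W₂)) fun b _ => h b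
  rw [← Finset.sum_mul, ← hS] at h1
  simp [Finset.card_univ, mul_comm] at h1

open scoped Classical in
/-- The counting bound: the signals `B`, `N`, `C` reveal `W₁` and carry no more than `W₁`, the
signals `A`, `M`, `N`, `C`, `D` reveal `W₂`, and `A → B → M → N` depend successively on each
other and alternately on one of the two messages. -/
theorem card_mul_card_le_of_chain {W₁ W₂ α β μ ν γ δ : Type*} [Fintype W₁] [Fintype W₂]
    [Fintype α] [Fintype β] [Fintype μ] [Fintype ν] [Fintype γ] [Fintype δ]
    (A : W₁ → W₂ → α) (B : W₁ → W₂ → β) (M : W₁ → W₂ → μ) (N : W₁ → W₂ → ν) (C : W₁ → W₂ → γ)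
    (D : W₁ → W₂ → δ) (est₁ : W₁ → W₂ → W₁) (est₂ : W₁ → W₂ → W₂)
    (hB : ∀ a a' b, A a b = A a' b → B a b = B a' b)
    (hM : ∀ a b b', B a b = B a b' → M a b = M a b')
    (hN : ∀ a a' b, M a b = M a' b → N a b = N a' b)
    (h₁ : ∀ a b a' b', B a b = B a' b' → N a b = N a' b' → C a b = C a' b' →
      est₁ a b = est₁ a' b')
    (h₂ : ∀ a b a' b', A a b = A a' b' → M a b = M a' b' → N a b = N a' b' → C a b = C a' b' →
      D a b = D a' b' → est₂ a b = est₂ a' b')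
    (hcard : Fintype.card (β × ν × γ) ≤ Fintype.card W₁) (Err : Finset (W₁ × W₂))
    (hErr : ∀ p, p ∉ Err → est₁ p.1 p.2 = p.1 ∧ est₂ p.1 p.2 = p.2) :
    Fintype.card W₁ * Fintype.card W₂ ≤ Fintype.card (α × μ × γ × δ) + 6 * Err.card := by
  rcases isEmpty_or_nonempty W₂ with h | h
  · simp
  obtain ⟨Bad, hBad, hsub, hpure⟩ := exists_pure_set (fun a b => (B a b, N a b, C a b)) est₁
    (fun a b a' b' h => by
      simp only [Prod.mk.injEq] at h
      exact h₁ _ _ _ _ h.1 h.2.1 h.2.2) hcard Err fun p hp => (hErr p hp).1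
  simp only [Prod.mk.injEq] at hpure
  -- Discarding every row that is bad at `b₀` at most doubles the bad set, whence `6 = 2 * 3`.
  obtain ⟨b₀, hb₀⟩ := exists_column_card_mul_le Bad
  set K := Finset.univ.filter fun a => (a, b₀) ∈ Bad with hK
  let Bad' : Finset (W₁ × W₂) := Bad ∪ K ×ˢ Finset.univ
  have hBad' : Bad'.card ≤ 6 * Err.card := by
    refine (Finset.card_union_le _ _).trans ?_
    rw [Finset.card_product, Finset.card_univ]
    omega
  have hgood : ∀ p, p ∈ Bad'ᶜ → p ∉ Bad ∧ (p.1, b₀) ∉ Bad := by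
    intro p hp
    simpa [Bad', K] using hp
  have hinj : Set.InjOn (fun p : W₁ × W₂ => (A p.1 p.2, M p.1 p.2, C p.1 p.2, D p.1 p.2))
      (Bad'ᶜ : Finset (W₁ × W₂)) := by
    rintro ⟨a, b⟩ hp ⟨a', b'⟩ hp' h
    obtain ⟨hp, hp₀⟩ := hgood _ hp
    obtain ⟨hp', hp₀'⟩ := hgood _ hp'
    simp only [Prod.mk.injEq] at h
    obtain ⟨hA, hM', hC, hD⟩ := h
    have e := hpure _ _ _ hp hp₀
    have e' := hpure _ _ _ hp' hp₀'
    -- Both pairs are moved to the column `b₀`, where equality of `M` forces equality of `N`.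
    have hN' : N a b = N a' b' := by
      rw [e.2.1, e'.2.1]
      exact hN _ _ _ ((hM _ _ _ e.1).symm.trans (hM'.trans (hM _ _ _ e'.1)))
    have g := hErr _ fun hh => hp (hsub hh)
    have g' := hErr _ fun hh => hp' (hsub hh)
    have hb : b = b' := g.2.symm.trans ((h₂ _ _ _ _ hA hM' hN' hC hD).trans g'.2)
    subst hb
    have ha : a = a' := g.1.symm.trans ((h₁ _ _ _ _ (hB _ _ _ hA) hN' hC).trans g'.1)
    rw [ha]
  have h1 := Finset.card_le_card_of_injOn _ (fun _ _ => Finset.mem_coe.2 (Finset.mem_univ _)) hinj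
  rw [Finset.card_univ] at h1
  have h2 := Finset.card_add_card_compl Bad'
  rw [Fintype.card_prod W₁ W₂] at h2
  omega

end Counting
-- Acyclicity, maximum flows and locality of codes.
namespace UnicastNetwork

variable {k : ℕ} {V E : Type}

/-- A directed multigraph whose edges increase a rank function is acyclic. -/
theorem not_transGen_self_of_rank {tail head : E → V} (rank : V → ℕ)
    (h : ∀ e, rank (tail e) < rank (head e)) (v : V) :
    ¬ Relation.TransGen (fun a b => ∃ e, tail e = a ∧ head e = b) v v := by
  have key : ∀ a b, Relation.TransGen (fun a b => ∃ e, tail e = a ∧ head e = b) a b →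
      rank a < rank b := by
    intro a b hab
    induction hab with
    | single h' => obtain ⟨e, rfl, rfl⟩ := h'; exact h e
    | tail _ h' ih => obtain ⟨e, rfl, rfl⟩ := h'; exact ih.trans (h e)
  exact fun hv => lt_irrefl _ (key v v hv)

open scoped Classical in
/-- A flow that saturates all edges leaving the source is a maximum flow. -/
theorem IsFlow.hasConnectivityLevel [Fintype E] {G : UnicastNetwork k V E} {i : Fin k} {f : E → ℝ}
    {β : ℕ} (hf : G.IsFlow i f) (hsat : ∀ e, G.tail e = G.source i → f e = 1)
    (hβ : (∑ e, if G.tail e = G.source i then 1 else 0) = β) : G.HasConnectivityLevel i β := by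
  have hin : ∀ g : E → ℝ, G.netFlow g (G.source i) = ∑ e with G.tail e = G.source i, g e := by
    intro g
    have : (Finset.univ.filter fun e => G.head e = G.source i) = ∅ :=
      Finset.filter_eq_empty_iff.2 fun e _ => G.head_ne_source e i
    rw [netFlow, this, Finset.sum_empty, sub_zero]
  have hβ' : (β : ℝ) = ∑ e with G.tail e = G.source i, (1 : ℝ) := by
    rw [← hβ, ← Finset.card_filter]
    simp
  refine ⟨⟨f, hf, ?_⟩, ?_⟩
  · rw [hin, hβ']
    exact Finset.sum_congr rfl fun e he => hsat e (by simpa using he)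
  · rintro x ⟨g, hg, rfl⟩
    rw [hin, hβ']
    exact Finset.sum_le_sum fun e _ => (hg.1 e).2

/-- The signal on an edge is determined by the messages and the signals seen at its tail. -/
theorem Code.signal_congr {G : UnicastNetwork k V E} {q n : ℕ} {M : Fin k → ℕ} (C : G.Code q n M)
    (e : E) (w w' : (i : Fin k) → Fin (M i)) (hw : ∀ i, G.source i = G.tail e → w i = w' i)
    (he : ∀ e', G.head e' = G.tail e → C.signal e' w = C.signal e' w') :
    C.signal e w = C.signal e w' := by
  rw [C.signal_eq e w, C.signal_eq e w']
  congr 1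
  · funext i
    exact hw i.1 i.2
  · funext e'
    exact he e'.1 e'.2

/-- The estimate at a terminal is determined by the signals on its incoming edges. -/
theorem Code.estimate_congr {G : UnicastNetwork k V E} {q n : ℕ} {M : Fin k → ℕ} (C : G.Code q n M)
    (i : Fin k) (w w' : (i : Fin k) → Fin (M i))
    (he : ∀ e', G.head e' = G.terminal i → C.signal e' w = C.signal e' w') :
    C.estimate w i = C.estimate w' i := by
  unfold Code.estimate
  congr 1
  funext e'
  exact he e'.1 e'.2

/-! ### The chain network and its connectivity levels. -/

/-- The nodes of the chain network: `m` gadgets with eight inner nodes each, and `r` gadgets with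
two inner nodes each, between the common sources and terminals. -/
inductive ChainNode (m r : ℕ) : Type
  | src (i : Fin 2)
  | dst (i : Fin 2)
  | chain (k : Fin m) (j : Fin 8)
  | link (k : Fin r) (j : Fin 2)

namespace ChainNode

variable {m r : ℕ}

instance : Finite (ChainNode m r) :=
  Finite.of_surjective
    (fun x : (Fin 2 ⊕ Fin 2) ⊕ (Fin m × Fin 8) ⊕ (Fin r × Fin 2) =>
      (match x with
        | .inl (.inl i) => src i
        | .inl (.inr i) => dst i
        | .inr (.inl (k, j)) => chain k j
        | .inr (.inr (k, j)) => link k j : ChainNode m r))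
    (by
      rintro (i | i | ⟨k, j⟩ | ⟨k, j⟩)
      · exact ⟨.inl (.inl i), rfl⟩
      · exact ⟨.inl (.inr i), rfl⟩
      · exact ⟨.inr (.inl (_, _)), rfl⟩
      · exact ⟨.inr (.inr (_, _)), rfl⟩)

/-- The position of a node in a topological order of the chain network. -/
def rank : ChainNode m r → ℕ
  | src _ => 0
  | dst _ => 9
  | chain _ j => j + 1
  | link _ j => j + 1

end ChainNode

/-- The edges of the chain network: those of the two kinds of gadgets, and `d` edges from the second
source to the second terminal. -/
abbrev ChainEdge (m r d : ℕ) : Type := (Fin m × Fin 17) ⊕ (Fin r × Fin 5) ⊕ Fin d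

open ChainNode

/-- The tail of an edge of the chain network. -/
def chainTail (m r d : ℕ) : ChainEdge m r d → ChainNode m r
  | .inl (k, j) => (![src 0, src 1, chain k 0, chain k 1, chain k 1, src 1, chain k 2, chain k 3,
      chain k 3, src 0, chain k 4, chain k 5, chain k 5, src 1, chain k 6, chain k 7,
      chain k 7] : Fin 17 → ChainNode m r) j
  | .inr (.inl (k, j)) =>
      (![src 0, src 1, link k 0, link k 1, link k 1] : Fin 5 → ChainNode m r) j
  | .inr (.inr _) => src 1

/-- The head of an edge of the chain network. -/
def chainHead (m r d : ℕ) : ChainEdge m r d → ChainNode m r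
  | .inl (k, j) => (![chain k 0, chain k 0, chain k 1, chain k 2, dst 1, chain k 2, chain k 3, dst 0,
      chain k 4, chain k 4, chain k 5, chain k 6, dst 1, chain k 6, chain k 7, dst 0,
      dst 1] : Fin 17 → ChainNode m r) j
  | .inr (.inl (k, j)) =>
      (![link k 0, link k 0, link k 1, dst 0, dst 1] : Fin 5 → ChainNode m r) j
  | .inr (.inr _) => dst 1

/-- The chain network.  In each of its `m` large gadgets two paths of the first session cross three
paths of the second session in four edges; in each of its `r` small gadgets one path of the first
session crosses one path of the second. -/
def chainNetwork (m r d : ℕ) : UnicastNetwork 2 (ChainNode m r) (ChainEdge m r d) where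
  tail := chainTail m r d
  head := chainHead m r d
  source := src
  terminal := dst
  acyclic := by
    refine not_transGen_self_of_rank rank ?_
    rintro (⟨k, j⟩ | ⟨k, j⟩ | j)
    · fin_cases j <;> simp [chainTail, chainHead, rank]
    · fin_cases j <;> simp [chainTail, chainHead, rank]
    · simp [chainTail, chainHead, rank]
  source_injective _ _ h := by simpa using h
  terminal_injective _ _ h := by simpa using h
  source_ne_terminal _ _ := by simp
  head_ne_source := by
    rintro (⟨k, j⟩ | ⟨k, j⟩ | j) i
    · fin_cases j <;> simp [chainHead]
    · fin_cases j <;> simp [chainHead]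
    · simp [chainHead]
  tail_ne_terminal := by
    rintro (⟨k, j⟩ | ⟨k, j⟩ | j) i
    · fin_cases j <;> simp [chainTail]
    · fin_cases j <;> simp [chainTail]
    · simp [chainTail]

/-- The flow of the first session in the chain network. -/
def chainFlow₀ (m r d : ℕ) : ChainEdge m r d → ℝ
  | .inl (_, j) => (![1, 0, 1, 1, 0, 0, 1, 1, 0, 1, 1, 1, 0, 0, 1, 1, 0] : Fin 17 → ℝ) j
  | .inr (.inl (_, j)) => (![1, 0, 1, 1, 0] : Fin 5 → ℝ) j
  | .inr (.inr _) => 0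

/-- The flow of the second session in the chain network. -/
def chainFlow₁ (m r d : ℕ) : ChainEdge m r d → ℝ
  | .inl (_, j) => (![0, 1, 1, 0, 1, 1, 1, 0, 1, 0, 1, 0, 1, 1, 1, 0, 1] : Fin 17 → ℝ) j
  | .inr (.inl (_, j)) => (![0, 1, 1, 0, 1] : Fin 5 → ℝ) j
  | .inr (.inr _) => 1

/-- A sum over the edges of the chain network, edge by edge. -/
theorem sum_chainEdge {R : Type*} [AddCommMonoid R] {m r d : ℕ} (g : ChainEdge m r d → R) :
    ∑ e, g e = ∑ k, (g (.inl (k, 0)) + g (.inl (k, 1)) + g (.inl (k, 2)) + g (.inl (k, 3)) +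
      g (.inl (k, 4)) + g (.inl (k, 5)) + g (.inl (k, 6)) + g (.inl (k, 7)) + g (.inl (k,
      8)) + g (.inl (k, 9)) + g (.inl (k, 10)) + g (.inl (k, 11)) + g (.inl (k, 12)) + g
      (.inl (k, 13)) + g (.inl (k, 14)) + g (.inl (k, 15)) + g (.inl (k, 16))) + (∑ k, (g
      (.inr (.inl (k, 0))) + g (.inr (.inl (k, 1))) + g (.inr (.inl (k, 2))) + g (.inr (.inl
      (k, 3))) + g (.inr (.inl (k, 4)))) +
      ∑ j, g (.inr (.inr j))) := by
  rw [Fintype.sum_sum_type, Fintype.sum_sum_type, Fintype.sum_prod_type, Fintype.sum_prod_type]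
  simp only [Fin.sum_univ_succ, Fin.sum_univ_zero, add_zero, add_assoc]
  rfl

open scoped Classical in
theorem chainNetwork_netFlow (m r d : ℕ) (f : ChainEdge m r d → ℝ) (v : ChainNode m r) :
    (chainNetwork m r d).netFlow f v =
      (∑ e, if chainTail m r d e = v then f e else 0) -
        ∑ e, if chainHead m r d e = v then f e else 0 := by
  rw [netFlow, Finset.sum_filter, Finset.sum_filter]
  rfl

/-- A sum of edge-disjoint unit paths: in a large gadget one through inner nodes 0–3 and one through
4–7. -/
theorem chainNetwork_isFlow₀ (m r d : ℕ) : (chainNetwork m r d).IsFlow 0 (chainFlow₀ m r d) := by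
  constructor
  · rintro (⟨k, j⟩ | ⟨k, j⟩ | j)
    · fin_cases j <;> simp [chainFlow₀]
    · fin_cases j <;> simp [chainFlow₀]
    · simp [chainFlow₀]
  · intro v h h'
    rw [chainNetwork_netFlow, sum_chainEdge, sum_chainEdge]
    rcases v with i | i | ⟨k, j⟩ | ⟨k, j⟩
    · fin_cases i
      · exact (h rfl).elim
      · simp [chainTail, chainHead, chainFlow₀]
    · fin_cases i
      · exact (h' rfl).elim
      · simp [chainTail, chainHead, chainFlow₀]
    · fin_cases j <;> simp [chainTail, chainHead, chainFlow₀]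
    · fin_cases j <;> simp [chainTail, chainHead, chainFlow₀]

/-- Here the paths in a large gadget run through inner nodes 0–1, 2–5 and 6–7. -/
theorem chainNetwork_isFlow₁ (m r d : ℕ) : (chainNetwork m r d).IsFlow 1 (chainFlow₁ m r d) := by
  constructor
  · rintro (⟨k, j⟩ | ⟨k, j⟩ | j)
    · fin_cases j <;> simp [chainFlow₁]
    · fin_cases j <;> simp [chainFlow₁]
    · simp [chainFlow₁]
  · intro v h h'
    rw [chainNetwork_netFlow, sum_chainEdge, sum_chainEdge]
    rcases v with i | i | ⟨k, j⟩ | ⟨k, j⟩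
    · fin_cases i
      · simp [chainTail, chainHead, chainFlow₁]
      · exact (h rfl).elim
    · fin_cases i
      · simp [chainTail, chainHead, chainFlow₁]
      · exact (h' rfl).elim
    · fin_cases j <;> simp [chainTail, chainHead, chainFlow₁]
    · fin_cases j <;> simp [chainTail, chainHead, chainFlow₁]

open scoped Classical in
theorem chainNetwork_hasConnectivityLevel₀ (m r d : ℕ) :
    (chainNetwork m r d).HasConnectivityLevel 0 (2 * m + r) := by
  refine (chainNetwork_isFlow₀ m r d).hasConnectivityLevel ?_ ?_
  · change ∀ e, chainTail m r d e = src 0 → chainFlow₀ m r d e = 1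
    rintro (⟨k, j⟩ | ⟨k, j⟩ | j)
    · fin_cases j <;> simp [chainTail, chainFlow₀]
    · fin_cases j <;> simp [chainTail, chainFlow₀]
    · simp [chainTail]
  · change (∑ e, if chainTail m r d e = src 0 then 1 else 0) = _
    rw [sum_chainEdge]
    simp [chainTail]
    ring

open scoped Classical in
theorem chainNetwork_hasConnectivityLevel₁ (m r d : ℕ) :
    (chainNetwork m r d).HasConnectivityLevel 1 (3 * m + r + d) := by
  refine (chainNetwork_isFlow₁ m r d).hasConnectivityLevel ?_ ?_
  · change ∀ e, chainTail m r d e = src 1 → chainFlow₁ m r d e = 1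
    rintro (⟨k, j⟩ | ⟨k, j⟩ | j)
    · fin_cases j <;> simp [chainTail, chainFlow₁]
    · fin_cases j <;> simp [chainTail, chainFlow₁]
    · simp [chainFlow₁]
  · change (∑ e, if chainTail m r d e = src 1 then 1 else 0) = _
    rw [sum_chainEdge]
    simp [chainTail]
    ring

end UnicastNetwork
-- Propagation of signals through the gadgets.
namespace UnicastNetwork
open ChainNode

/-- The signal on an edge that leaves a source is determined by the message of that source. -/
theorem Code.signal_congr_of_tail_eq_source {k : ℕ} {V E : Type} {G : UnicastNetwork k V E}
    {q n : ℕ} {M : Fin k → ℕ} (C : G.Code q n M) {e : E} {i : Fin k} (h : G.tail e = G.source i)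
    {w w' : (i : Fin k) → Fin (M i)} (hw : w i = w' i) : C.signal e w = C.signal e w' := by
  refine C.signal_congr e w w' (fun j hj => ?_) fun e' he' => ?_
  · obtain rfl : j = i := G.source_injective (hj.trans h)
    exact hw
  · exact (G.head_ne_source e' i (he'.trans h)).elim

/-- A property of all edges of the chain network, edge by edge. -/
theorem forall_chainEdge {m r d : ℕ} {P : ChainEdge m r d → Prop} :
    (∀ e, P e) ↔ (∀ k, P (.inl (k, 0)) ∧ P (.inl (k, 1)) ∧ P (.inl (k, 2)) ∧ P (.inl (k, 3))
      ∧ P (.inl (k, 4)) ∧ P (.inl (k, 5)) ∧ P (.inl (k, 6)) ∧ P (.inl (k, 7)) ∧ P (.inl (k,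
      8)) ∧ P (.inl (k, 9)) ∧ P (.inl (k, 10)) ∧ P (.inl (k, 11)) ∧ P (.inl (k, 12)) ∧ P
      (.inl (k, 13)) ∧ P (.inl (k, 14)) ∧ P (.inl (k, 15)) ∧ P (.inl (k, 16))) ∧ (∀ k, P
      (.inr (.inl (k, 0))) ∧ P (.inr (.inl (k, 1))) ∧ P (.inr (.inl (k, 2))) ∧ P (.inr (.inl
      (k, 3))) ∧ P (.inr (.inl (k, 4)))) ∧
      ∀ j, P (.inr (.inr j)) := by
  simp only [Sum.forall, Prod.forall, Fin.forall_fin_succ, Fin.forall_fin_zero, and_true]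
  rfl

/-! In the following lemmas the number in the name is the index of the edge within its gadget, as listed
in `chainTail` and `chainHead`: a relay edge follows a single edge, a join edge follows two. -/

section Signals

variable {m r d q n : ℕ} {M : Fin 2 → ℕ} (C : (chainNetwork m r d).Code q n M)
  {w w' : (i : Fin 2) → Fin (M i)}

theorem signal_relay_3 (k : Fin m)
    (h2 : C.signal (.inl (k, 2)) w = C.signal (.inl (k, 2)) w') :
    C.signal (.inl (k, 3)) w = C.signal (.inl (k, 3)) w' := by
  refine C.signal_congr _ w w' ?_ ?_
  · simp [chainNetwork, chainTail]
  · refine forall_chainEdge.2 ?_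
    simp [chainNetwork, chainTail, chainHead, h2]

theorem signal_relay_8 (k : Fin m)
    (h6 : C.signal (.inl (k, 6)) w = C.signal (.inl (k, 6)) w') :
    C.signal (.inl (k, 8)) w = C.signal (.inl (k, 8)) w' := by
  refine C.signal_congr _ w w' ?_ ?_
  · simp [chainNetwork, chainTail]
  · refine forall_chainEdge.2 ?_
    simp [chainNetwork, chainTail, chainHead, h6]

theorem signal_relay_11 (k : Fin m)
    (h10 : C.signal (.inl (k, 10)) w = C.signal (.inl (k, 10)) w') :
    C.signal (.inl (k, 11)) w = C.signal (.inl (k, 11)) w' := by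
  refine C.signal_congr _ w w' ?_ ?_
  · simp [chainNetwork, chainTail]
  · refine forall_chainEdge.2 ?_
    simp [chainNetwork, chainTail, chainHead, h10]

theorem signal_relay_7 (k : Fin m)
    (h6 : C.signal (.inl (k, 6)) w = C.signal (.inl (k, 6)) w') :
    C.signal (.inl (k, 7)) w = C.signal (.inl (k, 7)) w' := by
  refine C.signal_congr _ w w' ?_ ?_
  · simp [chainNetwork, chainTail]
  · refine forall_chainEdge.2 ?_
    simp [chainNetwork, chainTail, chainHead, h6]

theorem signal_relay_15 (k : Fin m)
    (h14 : C.signal (.inl (k, 14)) w = C.signal (.inl (k, 14)) w') :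
    C.signal (.inl (k, 15)) w = C.signal (.inl (k, 15)) w' := by
  refine C.signal_congr _ w w' ?_ ?_
  · simp [chainNetwork, chainTail]
  · refine forall_chainEdge.2 ?_
    simp [chainNetwork, chainTail, chainHead, h14]

theorem signal_relay_4 (k : Fin m)
    (h2 : C.signal (.inl (k, 2)) w = C.signal (.inl (k, 2)) w') :
    C.signal (.inl (k, 4)) w = C.signal (.inl (k, 4)) w' := by
  refine C.signal_congr _ w w' ?_ ?_
  · simp [chainNetwork, chainTail]
  · refine forall_chainEdge.2 ?_
    simp [chainNetwork, chainTail, chainHead, h2]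

theorem signal_relay_12 (k : Fin m)
    (h10 : C.signal (.inl (k, 10)) w = C.signal (.inl (k, 10)) w') :
    C.signal (.inl (k, 12)) w = C.signal (.inl (k, 12)) w' := by
  refine C.signal_congr _ w w' ?_ ?_
  · simp [chainNetwork, chainTail]
  · refine forall_chainEdge.2 ?_
    simp [chainNetwork, chainTail, chainHead, h10]

theorem signal_relay_16 (k : Fin m)
    (h14 : C.signal (.inl (k, 14)) w = C.signal (.inl (k, 14)) w') :
    C.signal (.inl (k, 16)) w = C.signal (.inl (k, 16)) w' := by
  refine C.signal_congr _ w w' ?_ ?_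
  · simp [chainNetwork, chainTail]
  · refine forall_chainEdge.2 ?_
    simp [chainNetwork, chainTail, chainHead, h14]

theorem signal_join_6 (k : Fin m)
    (h3 : C.signal (.inl (k, 3)) w = C.signal (.inl (k, 3)) w') 
    (h5 : C.signal (.inl (k, 5)) w = C.signal (.inl (k, 5)) w') :
    C.signal (.inl (k, 6)) w = C.signal (.inl (k, 6)) w' := by
  refine C.signal_congr _ w w' ?_ ?_
  · simp [chainNetwork, chainTail]
  · refine forall_chainEdge.2 ?_
    simp [chainNetwork, chainTail, chainHead, forall_and, h3, h5]

theorem signal_join_10 (k : Fin m)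
    (h8 : C.signal (.inl (k, 8)) w = C.signal (.inl (k, 8)) w') 
    (h9 : C.signal (.inl (k, 9)) w = C.signal (.inl (k, 9)) w') :
    C.signal (.inl (k, 10)) w = C.signal (.inl (k, 10)) w' := by
  refine C.signal_congr _ w w' ?_ ?_
  · simp [chainNetwork, chainTail]
  · refine forall_chainEdge.2 ?_
    simp [chainNetwork, chainTail, chainHead, forall_and, h8, h9]

theorem signal_join_14 (k : Fin m)
    (h11 : C.signal (.inl (k, 11)) w = C.signal (.inl (k, 11)) w') 
    (h13 : C.signal (.inl (k, 13)) w = C.signal (.inl (k, 13)) w') :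
    C.signal (.inl (k, 14)) w = C.signal (.inl (k, 14)) w' := by
  refine C.signal_congr _ w w' ?_ ?_
  · simp [chainNetwork, chainTail]
  · refine forall_chainEdge.2 ?_
    simp [chainNetwork, chainTail, chainHead, forall_and, h11, h13]

theorem signal_link_3 (k : Fin r)
    (h2 : C.signal (.inr (.inl (k, 2))) w = C.signal (.inr (.inl (k, 2))) w') :
    C.signal (.inr (.inl (k, 3))) w = C.signal (.inr (.inl (k, 3))) w' := by
  refine C.signal_congr _ w w' ?_ ?_
  · simp [chainNetwork, chainTail]
  · refine forall_chainEdge.2 ?_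
    simp [chainNetwork, chainTail, chainHead, h2]

theorem signal_link_4 (k : Fin r)
    (h2 : C.signal (.inr (.inl (k, 2))) w = C.signal (.inr (.inl (k, 2))) w') :
    C.signal (.inr (.inl (k, 4))) w = C.signal (.inr (.inl (k, 4))) w' := by
  refine C.signal_congr _ w w' ?_ ?_
  · simp [chainNetwork, chainTail]
  · refine forall_chainEdge.2 ?_
    simp [chainNetwork, chainTail, chainHead, h2]

theorem estimate_zero_congr
    (h₇ : ∀ k, C.signal (.inl (k, 7)) w = C.signal (.inl (k, 7)) w')
    (h₁₅ : ∀ k, C.signal (.inl (k, 15)) w = C.signal (.inl (k, 15)) w')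
    (h₃ : ∀ k, C.signal (.inr (.inl (k, 3))) w = C.signal (.inr (.inl (k, 3))) w') :
    C.estimate w 0 = C.estimate w' 0 := by
  refine C.estimate_congr 0 w w' ?_
  rw [forall_chainEdge]
  simp [chainNetwork, chainHead, h₇, h₁₅, h₃]

theorem estimate_one_congr
    (h₄ : ∀ k, C.signal (.inl (k, 4)) w = C.signal (.inl (k, 4)) w')
    (h₁₂ : ∀ k, C.signal (.inl (k, 12)) w = C.signal (.inl (k, 12)) w')
    (h₁₆ : ∀ k, C.signal (.inl (k, 16)) w = C.signal (.inl (k, 16)) w')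
    (hl : ∀ k, C.signal (.inr (.inl (k, 4))) w = C.signal (.inr (.inl (k, 4))) w')
    (hd : ∀ k, C.signal (.inr (.inr k)) w = C.signal (.inr (.inr k)) w') :
    C.estimate w 1 = C.estimate w' 1 := by
  refine C.estimate_congr 1 w w' ?_
  rw [forall_chainEdge]
  simp [chainNetwork, chainHead, h₄, h₁₂, h₁₆, hl, hd]

end Signals
end UnicastNetwork
-- The converse bound and the choice of parameters.
namespace UnicastNetwork
open ChainNode

open scoped Classical in
/-- The converse bound for the chain network: up to the error event, the number of pairs of messages
is at most the number of values of `2 m + r + d` edge signals. -/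
theorem chainNetwork_card_le {m r d q n : ℕ} {M : Fin 2 → ℕ} (C : (chainNetwork m r d).Code q n M)
    (hM : (q ^ n) ^ (2 * m + r) ≤ M 0) :
    M 0 * M 1 ≤ (q ^ n) ^ (2 * m + r + d) +
      6 * (Finset.univ.filter fun w : (i : Fin 2) → Fin (M i) => ∃ i, C.estimate w i ≠ w i).card := by
  let mk : Fin (M 0) → Fin (M 1) → (i : Fin 2) → Fin (M i) :=
    fun a b => (piFinTwoEquiv fun i => Fin (M i)).symm (a, b)
  have key := card_mul_card_le_of_chain
    -- Edges 2, 6, 10, 14 are the bottlenecks; each letter collects its edge over all gadgets.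
    (A := fun a b (k : Fin m) => C.signal (.inl (k, 2)) (mk a b))
    (B := fun a b (k : Fin m) => C.signal (.inl (k, 6)) (mk a b))
    (M := fun a b (k : Fin m) => C.signal (.inl (k, 10)) (mk a b))
    (N := fun a b (k : Fin m) => C.signal (.inl (k, 14)) (mk a b))
    (C := fun a b (k : Fin r) => C.signal (.inr (.inl (k, 2))) (mk a b))
    (D := fun a b (k : Fin d) => C.signal (.inr (.inr k)) (mk a b))
    (est₁ := fun a b => C.estimate (mk a b) 0) (est₂ := fun a b => C.estimate (mk a b) 1)
    (fun a a' b h => funext fun k => signal_join_6 C k (signal_relay_3 C k (congrFun h k))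
      (C.signal_congr_of_tail_eq_source (i := 1) rfl rfl))
    (fun a b b' h => funext fun k => signal_join_10 C k (signal_relay_8 C k (congrFun h k))
      (C.signal_congr_of_tail_eq_source (i := 0) rfl rfl))
    (fun a a' b h => funext fun k => signal_join_14 C k (signal_relay_11 C k (congrFun h k))
      (C.signal_congr_of_tail_eq_source (i := 1) rfl rfl))
    (fun a b a' b' hB hN hC => estimate_zero_congr C
      (fun k => signal_relay_7 C k (congrFun hB k)) (fun k => signal_relay_15 C k (congrFun hN k))
      (fun k => signal_link_3 C k (congrFun hC k)))
    (fun a b a' b' hA hM hN hC hD => estimate_one_congr C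
      (fun k => signal_relay_4 C k (congrFun hA k)) (fun k => signal_relay_12 C k (congrFun hM k))
      (fun k => signal_relay_16 C k (congrFun hN k)) (fun k => signal_link_4 C k (congrFun hC k))
      (fun k => congrFun hD k))
    (by
      refine le_trans (le_of_eq ?_) (hM.trans_eq (Fintype.card_fin _).symm)
      simp only [Fintype.card_prod, Fintype.card_pi, Fintype.card_fin, Finset.prod_const,
        Finset.card_univ]
      ring)
    ((Finset.univ.filter fun w => ∃ i, C.estimate w i ≠ w i).map
      (piFinTwoEquiv fun i => Fin (M i)).toEmbedding)
    (by
      rintro ⟨a, b⟩ hp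
      have hw : ∀ i, C.estimate (mk a b) i = mk a b i := by
        by_contra! hw
        exact hp (Finset.mem_map.2 ⟨mk a b, by simpa using hw, rfl⟩)
      exact ⟨hw 0, hw 1⟩)
  rw [Finset.card_map] at key
  refine le_trans (le_of_eq (by simp)) (key.trans_eq ?_)
  simp only [Fintype.card_prod, Fintype.card_pi, Fintype.card_fin, Finset.prod_const,
    Finset.card_univ]
  ring

/-- The chain network does not support the full rate of the first session together with a rate of
the second session that exceeds the converse bound by half an edge. -/
theorem chainNetwork_not_supports {m r d : ℕ} {R : Fin 2 → ℝ} (h₀ : R 0 = (2 * m + r : ℕ))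
    (h₁ : (d : ℝ) + 1 / 2 ≤ R 1) : ¬ (chainNetwork m r d).Supports R := by
  intro h
  -- Errors then cost at most `6/60` of all pairs, and `(9/10) * (7/5) > 1` gives the contradiction.
  obtain ⟨q, n, hq, hn, M, hM, C, hC⟩ := h (1 / 60) (by norm_num)
  have hq1 : (1 : ℝ) ≤ q := by exact_mod_cast (by omega : 1 ≤ q)
  have hq0 : (0 : ℝ) < q := by linarith
  have hM0 : (q ^ n) ^ (2 * m + r) ≤ M 0 := by
    have := hM 0
    rw [h₀, ← Nat.cast_mul, Real.rpow_natCast, pow_mul] at this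
    exact_mod_cast this
  have key := chainNetwork_card_le C hM0
  have hM1 : (q : ℝ) ^ ((n : ℝ) * (d : ℝ)) * (q : ℝ) ^ ((n : ℝ) / 2) ≤ M 1 := by
    rw [← Real.rpow_add hq0]
    refine (Real.rpow_le_rpow_of_exponent_le hq1 ?_).trans (hM 1)
    nlinarith [Nat.cast_nonneg (α := ℝ) n]
  -- The half edge of excess rate is worth at least a factor `√2`, the worst case being `q = 2`, `n
  -- = 1`.
  have hroot : (7 / 5 : ℝ) ≤ (q : ℝ) ^ ((n : ℝ) / 2) := by
    have hn' : (1 : ℝ) ≤ n := by exact_mod_cast hn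
    have h2 : (2 : ℝ) ≤ q := by exact_mod_cast hq
    calc (7 / 5 : ℝ) ≤ √2 := Real.le_sqrt_of_sq_le (by norm_num)
      _ = (2 : ℝ) ^ (1 / 2 : ℝ) := Real.sqrt_eq_rpow 2
      _ ≤ (q : ℝ) ^ (1 / 2 : ℝ) := Real.rpow_le_rpow (by norm_num) h2 (by norm_num)
      _ ≤ (q : ℝ) ^ ((n : ℝ) / 2) := Real.rpow_le_rpow_of_exponent_le hq1 (by linarith)
  rw [← Nat.cast_mul, Real.rpow_natCast, pow_mul] at hM1
  set Q : ℝ := (q : ℝ) ^ n with hQ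
  have hQ0 : 0 < Q := by positivity
  have hM0' : Q ^ (2 * m + r) ≤ (M 0 : ℝ) := by
    rw [hQ]
    exact_mod_cast hM0
  have hcard : (Fintype.card ((i : Fin 2) → Fin (M i)) : ℝ) = M 0 * M 1 := by
    simp [Fintype.card_pi, Fin.prod_univ_two]
  have hd : 0 < Q ^ d := by positivity
  have hM1' : 7 / 5 * Q ^ d ≤ (M 1 : ℝ) := by nlinarith
  have hprod : 7 / 5 * (Q ^ (2 * m + r) * Q ^ d) ≤ (M 0 : ℝ) * M 1 :=
    calc 7 / 5 * (Q ^ (2 * m + r) * Q ^ d) = Q ^ (2 * m + r) * (7 / 5 * Q ^ d) := by ring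
      _ ≤ _ := mul_le_mul hM0' hM1' (by positivity) (by positivity)
  have hpos : 0 < Q ^ (2 * m + r) * Q ^ d := by positivity
  rw [Code.errorProb, hcard, div_le_iff₀ (by linarith)] at hC
  have key' := (Nat.cast_le (α := ℝ)).2 key
  rw [pow_add] at key'
  push_cast at key'
  rw [← hQ] at key'
  linarith

end UnicastNetwork

theorem mainTheorem7 (n₁ n₂ : ℕ) (hn₁ : 1 < n₁) (hn₂ : 3 * (n₁ : ℝ) / 2 ≤ (n₂ : ℝ)) :
    ∃ (V E : Type) (_ : Fintype V) (_ : Fintype E) (G : UnicastNetwork 2 V E),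
      G.HasConnectivityLevel 0 n₁ ∧ G.HasConnectivityLevel 1 n₂ ∧
        ¬ G.Supports ![(n₁ : ℝ), (n₂ : ℝ) - 3 * (n₁ : ℝ) / 2 + 1] := by
  have hn : 3 * n₁ ≤ 2 * n₂ := by
    have : 3 * (n₁ : ℝ) ≤ 2 * n₂ := by linarith
    exact_mod_cast this
  -- A small gadget is needed only for odd `n₁`. The second rate becomes `d + 1 - r / 2`, at least
  -- `d + 1 / 2`.
  obtain ⟨m, r, hr, rfl⟩ : ∃ m r, r ≤ 1 ∧ n₁ = 2 * m + r := ⟨n₁ / 2, n₁ % 2, by omega, by omega⟩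
  obtain ⟨d, rfl⟩ : ∃ d, n₂ = 3 * m + r + d := ⟨n₂ - (3 * m + r), by omega⟩
  refine ⟨_, _, Fintype.ofFinite _, inferInstance, UnicastNetwork.chainNetwork m r d,
    UnicastNetwork.chainNetwork_hasConnectivityLevel₀ m r d,
    UnicastNetwork.chainNetwork_hasConnectivityLevel₁ m r d,
    UnicastNetwork.chainNetwork_not_supports rfl ?_⟩
  have hr' : (r : ℝ) ≤ 1 := by exact_mod_cast hr
  simp only [Matrix.cons_val_one, Matrix.cons_val_fin_one]
  push_cast
  linarith
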